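/- **Setting.** All measurable spaces are standard Borel; for a finite tuple $\mathbf A=(A_1,\dots,A_m)$ of objects with underlying spaces $\underline{A_i}$ put $\underline{\mathbf A}=\prod_i\underline{A_i}$. A *Markov polycategory* has objects $X$ with underlying spaces $\underline X$, and as morphisms $\mathbf A\to\mathbf B$ a set of Markov kernels $\underline{\mathbf A}\to\underline{\mathbf B}$, containing the identity kernels and closed under slotwise composition (connect one output slot of a kernel to one input slot of another carrying the same object and integrate that wire out). A *color system* $(\mathcal K,\mathcal M,\iota)$ consists of a category $\mathcal K$, an ordered polycategory $\mathcal M$ on the objects of $\mathcal K$, and a functorial assignment $\iota$ sending $f:c\to d$ in $\mathcal K$ to a morphism $\iota(f):(c)\to(d)$ of $\mathcal M$. A *colored Markov polycategory* (CMP) over it is a Markov polycategory $\mathcal P$ with object colors $\chi(X)\in\mathcal K$, morphism colors $\psi(k)\in\mathrm{Hom}_{\mathcal M}(\chi(\mathbf A);\chi(\mathbf B))$ preserving identities and slotwise composition, and an interface system: sets $\mathrm{Int}(B,C)\subseteq\mathcal K(\chi(B),\chi(C))$ containing identities and closed under composition, with interface kernels $\kappa_f:(B)\to(C)$ in $\mathcal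 P$ such that $\psi(\kappa_f)=\iota(f)$, $\kappa_{\mathrm{id}}=\mathrm{id}$, $\kappa_{g\circ f}=\kappa_g\circ\kappa_f$. **Diagrams.** A *parameterized finite acyclic diagram* $D$ in a CMP consists of a finite vertex set $V$ with input and output profiles $\mathbf A_u,\mathbf B_u$; finitely many internal wires $e$, each joining an output slot (object $B$) of a vertex to an input slot (object $C$) of a vertex and carrying a fixed witness $f_e\in\mathrm{Int}(B,C)$, such that every slot lies on at most one wire and the induced directed graph on $V$ is acyclic; orderings of the unwired input slots and of the unwired output slots (giving the external profiles $\mathbf I_D,\mathbf O_D$); a subset $V_{\rm par}\subseteq V$ with, for each $u\in V_{\rm par}$, a finite-dimensional real vector space $\Theta_u$ and a family $(k_{u,t}:\mathbf A_u\to\mathbf B_u)_{t\in\Theta_u}$ of morphisms of constant morphism color, jointly measurable in $(t,\mathbf a)$; and a fixed morphism $\mathbf A_u\to\mathbf B_u$ for each $u\in V\setminus V_{\rm par}$. Put $\Theta_D=\prod_{u\in V_{\rm par}}\Theta_u$. Insert on every internal wire $e$ a unary vertex with kernel $\kappa_{f_e}$; let $\widehat V$ be the enlarged vertex set. For $\theta\in\Theta_D$,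 evaluating all vertices in a topological order, each kernel being applied to its wired and external inputs, gives a kernel $\mu^\theta(\cdot\mid\mathbf x)$ from $\underline{\mathbf I_D}$ to $\prod_{n\in\widehat V}\underline{\mathbf B_n}$ (the claim below holds for any choice of topological order). Its image under projection to the external output slots is the kernel $K_D^\theta$. Let $\mathbf R$ be a finite tuple of reference objects, $\rho$ a probability measure on $\underline{\mathbf I_D}\times\underline{\mathbf R}$ and $f_O:\underline{\mathbf O_D}\times\underline{\mathbf R}\to\mathbb R$ measurable. Define the full trace law, the random objective and the expected objective by $$\nu_D^\theta(d\mathbf x,d\mathbf r,d\mathbf y)=\rho(d\mathbf x,d\mathbf r)\,\mu^\theta(d\mathbf y\mid\mathbf x),\qquad J=f_O(\mathbf Y_D,\mathbf R),\qquad \mathcal L_D(\theta)=\int\Big(\int f_O(\mathbf y,\mathbf r)\,K_D^\theta(d\mathbf y\mid\mathbf x)\Big)\rho(d\mathbf x,d\mathbf r),$$ where $\mathbf Y_D$ is the external output of the trace. When $J$ is integrable, $\mathcal L_D(\theta)=\mathbb E_{\nu_D^\theta}[J]$. Let $\overline{\mathbf A}_u,\overline{\mathbf B}_u$ be the input and output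 of the vertex $u$, as functions of the trace. **Local notions**, for $u\in V_{\rm par}$. * An *admissible local context* is a measurable function $\overline{\mathbf S}_u$ of the trace, with values in a standard Borel space $\underline{\mathbf S_u}$, such that for all values $\theta_{-u}$ of the other parameters there is a probability measure $\lambda$ on $\underline{\mathbf A_u}\times\underline{\mathbf S_u}$, independent of $\theta_u$, with $$\mathbb E_{\nu_D^\theta}[\varphi(\overline{\mathbf A}_u,\overline{\mathbf B}_u,\overline{\mathbf S}_u)]=\int\Big(\int\varphi(\mathbf a,\mathbf b,\mathbf s)\,k_{u,\theta_u}(d\mathbf b\mid\mathbf a)\Big)\lambda(d\mathbf a,d\mathbf s)$$ for all $\theta_u\in\Theta_u$ and all bounded measurable $\varphi$. * A *conditional expected future objective* at $\theta$ is a measurable $Q_u:\underline{\mathbf A_u}\times\underline{\mathbf B_u}\times\underline{\mathbf S_u}\to\mathbb R$, depending on $\theta_{-u}$ but not on the parameter $t$ of $u$, such that for all $t$ in a neighborhood of $\theta_u$, with $\theta'=(t,\theta_{-u})$, $$Q_u(\overline{\mathbf A}_u,\overline{\mathbf B}_u,\overline{\mathbf S}_u)=\mathbb E_{\nu_D^{\theta'}}[J\mid\sigma(\overline{\mathbf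 A}_u,\overline{\mathbf B}_u,\overline{\mathbf S}_u)]\quad\nu_D^{\theta'}\text{-a.s.}$$ * An *admissible local gradient operator*, relative to $\underline{\mathbf S_u}$ and a class $\mathcal Q$ of measurable functions $Q:\underline{\mathbf A_u}\times\underline{\mathbf B_u}\times\underline{\mathbf S_u}\to\mathbb R$, assigns to each $Q\in\mathcal Q$ a measurable $G_{u,Q}:\Theta_u\times\underline{\mathbf A_u}\times\underline{\mathbf B_u}\times\underline{\mathbf S_u}\to\Theta_u^*$ such that, for every probability measure $\lambda$ on $\underline{\mathbf A_u}\times\underline{\mathbf S_u}$ and every $t\in\Theta_u$: if $F_Q(t')=\int\!\int Q(\mathbf a,\mathbf b,\mathbf s)\,k_{u,t'}(d\mathbf b\mid\mathbf a)\,\lambda(d\mathbf a,d\mathbf s)$ converges absolutely for $t'$ near $t$ and is differentiable at $t$, and the following integral converges absolutely, then $$DF_Q(t)=\int\Big(\int G_{u,Q}(t,\mathbf a,\mathbf b,\mathbf s)\,k_{u,t}(d\mathbf b\mid\mathbf a)\Big)\lambda(d\mathbf a,d\mathbf s).$$ **Theorem (Reverse-mode differentiation for finite acyclic CKSC diagrams).**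 Let $D,\mathbf R,\rho,f_O$ be as above and fix $\theta\in\Theta_D$. Assume that $J$ is $\nu_D^{\theta'}$-integrable for all $\theta'$ in a neighborhood of $\theta$ and that $\mathcal L_D$ is differentiable at $\theta$. For each $u\in V_{\rm par}$ let $\overline{\mathbf S}_u$ be an admissible local context, $Q_u$ a conditional expected future objective at $\theta$, and $G_u$ an admissible local gradient operator relative to a class containing $Q_u$, such that the random covector $$\mathcal G_u^\theta=G_{u,Q_u}(\theta_u,\overline{\mathbf A}_u,\overline{\mathbf B}_u,\overline{\mathbf S}_u)\in\Theta_u^*$$ is $\nu_D^\theta$-integrable. Then $$D\mathcal L_D(\theta)=\big(\mathbb E_{\nu_D^\theta}[\mathcal G_u^\theta]\big)_{u\in V_{\rm par}}\in\prod_{u\in V_{\rm par}}\Theta_u^*\simeq\Theta_D^*,$$ that is, $D\mathcal L_D(\theta)[\eta]=\sum_{u\in V_{\rm par}}\mathbb E_{\nu_D^\theta}[\mathcal G_u^\theta][\eta_u]$ for all $\eta\in\Theta_D$, and the restriction of $D\mathcal L_D(\theta)$ to the factor $\Theta_u$ is $\mathbb E_{\nu_D^\theta}[\mathcal G_u^\theta]$.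 -/

import Mathlib

open MeasureTheory ProbabilityTheory CategoryTheory Topology

noncomputable section

universe u₁ u₂ u₃ u₄ u₅ u₆ u₇ u₈

/-! ## Tuples of values -/

/-- The underlying product space of a finite ordered tuple (a list) of objects. -/
abbrev Val {Ob : Type u₁} (carrier : Ob → Type u₂) (A : List Ob) : Type u₂ :=
  (i : Fin A.length) → carrier (A.get i)

namespace Val

variable {Ob : Type u₁} {carrier : Ob → Type u₂}

/-- Prepend a value to a tuple. -/
def cons {X : Ob} {A : List Ob} (x : carrier X) (a : Val carrier A) : Val carrier (X :: A) :=
  Fin.cons (α := fun i : Fin (A.length + 1) => carrier ((X :: A).get i)) x a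

/-- The first entry of a non-empty tuple. -/
def head {X : Ob} {A : List Ob} (v : Val carrier (X :: A)) : carrier X :=
  v (0 : Fin (A.length + 1))

/-- All entries of a non-empty tuple except the first. -/
def tail {X : Ob} {A : List Ob} (v : Val carrier (X :: A)) : Val carrier A :=
  fun i => v i.succ

/-- The empty tuple. -/
def nil : Val carrier ([] : List Ob) := fun i => i.elim0

/-- The one-entry tuple. -/
def single {X : Ob} (x : carrier X) : Val carrier [X] := cons x nil

/-- Concatenation of tuples. -/
def append : (A : List Ob) → {B : List Ob} → Val carrier A → Val carrier B →
    Val carrier (A ++ B)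
  | [], _, _, b => b
  | X :: A, _, a, b => cons (X := X) (head a) (append A (tail a) b)

/-- The initial part of a concatenated tuple. -/
def left : (A : List Ob) → {B : List Ob} → Val carrier (A ++ B) → Val carrier A
  | [], _, _ => nil
  | X :: A, B, v => cons (X := X) (head (A := A ++ B) v) (left A (tail (A := A ++ B) v))

/-- The final part of a concatenated tuple. -/
def right : (A : List Ob) → {B : List Ob} → Val carrier (A ++ B) → Val carrier B
  | [], _, v => v
  | _ :: A, B, v => right A (tail (A := A ++ B) v)

/-- The tuple obtained by listing the values of a family along a list of labels. -/
def ofList {ι : Type u₃} (obj : ι → Ob) : (L : List ι) → ((s : ι) → carrier (obj s)) →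
    Val carrier (L.map obj)
  | [], _ => nil
  | s :: L, y => cons (X := obj s) (y s) (ofList obj L y)

open Classical in
/-- The entry of a tuple, whose entries are labelled by a list `L`, at the label `s ∈ L`. -/
def lookup {ι : Type u₃} (obj : ι → Ob) (s : ι) : (L : List ι) → s ∈ L →
    Val carrier (L.map obj) → carrier (obj s)
  | [], h, _ => absurd h (by simp)
  | t :: L, h, v =>
    if e : t = s then e ▸ head (X := obj t) v
    else lookup obj s L
      ((List.mem_cons.1 h).resolve_left fun h' => e h'.symm) (tail (X := obj t) v)

variable [∀ X, MeasurableSpace (carrier X)]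

theorem measurable_cons {X : Ob} {A : List Ob} :
    Measurable fun p : carrier X × Val carrier A => (cons p.1 p.2 : Val carrier (X :: A)) := by
  refine measurable_pi_iff.2 fun i => ?_
  refine Fin.cases ?_ (fun j => ?_) i
  · exact measurable_fst
  · exact (measurable_pi_apply j).comp measurable_snd

theorem measurable_head {X : Ob} {A : List Ob} :
    Measurable (head : Val carrier (X :: A) → carrier X) :=
  measurable_pi_apply _

theorem measurable_tail {X : Ob} {A : List Ob} :
    Measurable (tail : Val carrier (X :: A) → Val carrier A) :=
  measurable_pi_iff.2 fun i => measurable_pi_apply (Fin.succ i)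

theorem measurable_single {X : Ob} : Measurable (single : carrier X → Val carrier [X]) :=
  measurable_cons.comp (measurable_id.prodMk measurable_const)

theorem measurable_append (A : List Ob) {B : List Ob} :
    Measurable fun p : Val carrier A × Val carrier B => append A p.1 p.2 := by
  induction A with
  | nil => exact measurable_snd
  | cons X A ih =>
    exact measurable_cons.comp ((measurable_head.comp measurable_fst).prodMk
      (ih.comp ((measurable_tail.comp measurable_fst).prodMk measurable_snd)))

theorem measurable_left (A : List Ob) {B : List Ob} :
    Measurable (left A : Val carrier (A ++ B) → Val carrier A) := by
  induction A with
  | nil => exact measurable_const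
  | cons X A ih =>
    exact measurable_cons.comp ((measurable_head (A := A ++ B)).prodMk
      (ih.comp (measurable_tail (A := A ++ B))))

theorem measurable_right (A : List Ob) {B : List Ob} :
    Measurable (right A : Val carrier (A ++ B) → Val carrier B) := by
  induction A with
  | nil => exact measurable_id
  | cons X A ih => exact ih.comp (measurable_tail (A := A ++ B))

theorem measurable_lookup {ι : Type u₃} (obj : ι → Ob) (s : ι) (L : List ι) (h : s ∈ L) :
    Measurable (lookup obj s L h : Val carrier (L.map obj) → carrier (obj s)) := by
  induction L with
  | nil => exact absurd h (by simp)
  | cons t L ih =>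
    by_cases e : t = s
    · subst e
      have : (lookup obj t (t :: L) h : Val carrier ((t :: L).map obj) → carrier (obj t)) =
          fun v => head (X := obj t) v := by
        funext v; simp [lookup]
      rw [this]
      exact measurable_head (X := obj t)
    · have h' : s ∈ L := (List.mem_cons.1 h).resolve_left fun h' => e h'.symm
      have : (lookup obj s (t :: L) h : Val carrier ((t :: L).map obj) → carrier (obj s)) =
          fun v => lookup obj s L h' (tail (X := obj t) v) := by
        funext v; simp [lookup, e]
      rw [this]
      exact (ih h').comp (measurable_tail (X := obj t))

end Val

/-! ## Kernel slotwise composition and Markov polycategories -/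

/-- Kernel slotwise composition `l ∘ k`: the output slot `X` of `k` is connected to the input
slot `X` of `l`, and the internal wire is integrated out.  On the input `(c₁, a, c₂)` one draws
`(b₁, x, b₂)` from `k(· ∣ a)`, then `d` from `l(· ∣ c₁, x, c₂)`, and returns `(b₁, d, b₂)`. -/
def ksc {Ob : Type u₁} {carrier : Ob → Type u₂} [∀ X, MeasurableSpace (carrier X)]
    {A D : List Ob} (B₁ B₂ C₁ C₂ : List Ob) (X : Ob)
    (l : Kernel (Val carrier (C₁ ++ X :: C₂)) (Val carrier D))
    (k : Kernel (Val carrier A) (Val carrier (B₁ ++ X :: B₂))) :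
    Kernel (Val carrier (C₁ ++ (A ++ C₂))) (Val carrier (B₁ ++ (D ++ B₂))) :=
  ((k.comap (fun v => Val.left A (Val.right C₁ v))
      ((Val.measurable_left A).comp (Val.measurable_right C₁))) ⊗ₖ
    (l.comap
      (fun p : Val carrier (C₁ ++ (A ++ C₂)) × Val carrier (B₁ ++ X :: B₂) =>
        Val.append C₁ (Val.left C₁ p.1)
          (Val.cons (Val.head (Val.right B₁ p.2)) (Val.right A (Val.right C₁ p.1))))
      ((Val.measurable_append C₁).comp
        (((Val.measurable_left C₁).comp measurable_fst).prodMk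
          (Val.measurable_cons.comp
            ((Val.measurable_head.comp ((Val.measurable_right B₁).comp measurable_snd)).prodMk
              ((Val.measurable_right A).comp
                ((Val.measurable_right C₁).comp measurable_fst)))))))).map
    (fun q : Val carrier (B₁ ++ X :: B₂) × Val carrier D =>
      Val.append B₁ (Val.left B₁ q.1) (Val.append D q.2 (Val.tail (Val.right B₁ q.1))))

/-- A Markov polycategory: objects carry standard Borel spaces, the morphisms `A ⟶ B` between
finite ordered tuples are Markov kernels between the product spaces, and they contain the
identity kernels and are closed under kernel slotwise composition. -/
structure MarkovPolycategory where
  Ob : Type u₁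
  carrier : Ob → Type u₂
  [measurableSpace : ∀ X, MeasurableSpace (carrier X)]
  [standardBorel : ∀ X, StandardBorelSpace (carrier X)]
  Hom : (A B : List Ob) → Set (Kernel (Val carrier A) (Val carrier B))
  isMarkov : ∀ {A B : List Ob} {k : Kernel (Val carrier A) (Val carrier B)},
    k ∈ Hom A B → IsMarkovKernel k
  id_mem : ∀ X : Ob, (Kernel.id : Kernel (Val carrier [X]) (Val carrier [X])) ∈ Hom [X] [X]
  ksc_mem : ∀ {A D : List Ob} (B₁ B₂ C₁ C₂ : List Ob) (X : Ob)
    {l : Kernel (Val carrier (C₁ ++ X :: C₂)) (Val carrier D)}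
    {k : Kernel (Val carrier A) (Val carrier (B₁ ++ X :: B₂))},
    l ∈ Hom (C₁ ++ X :: C₂) D → k ∈ Hom A (B₁ ++ X :: B₂) →
    ksc B₁ B₂ C₁ C₂ X l k ∈ Hom (C₁ ++ (A ++ C₂)) (B₁ ++ (D ++ B₂))

attribute [instance] MarkovPolycategory.measurableSpace MarkovPolycategory.standardBorel

/-- The standard Borel space underlying a finite ordered tuple of objects. -/
abbrev MarkovPolycategory.Space (P : MarkovPolycategory.{u₁, u₂}) (A : List P.Ob) : Type u₂ :=
  Val P.carrier A

/-! ## Color systems and colored Markov polycategories -/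

/-- An ordered polycategory with set of objects `C`.  The slotwise composite of
`k : A ⟶ (B₁, X, B₂)` and `l : (C₁, X, C₂) ⟶ D` is a morphism `(C₁, A, C₂) ⟶ (B₁, D, B₂)`.
Profiles are compared through explicit equalities of lists.  The interchange laws are imposed
for those composites whose ordered external slots agree. -/
structure OrderedPolycategory (C : Type u₁) where
  Hom : List C → List C → Type u₂
  id : (X : C) → Hom [X] [X]
  comp : ∀ {A B E D Γ Δ : List C} (B₁ B₂ C₁ C₂ : List C) (X : C),
    B = B₁ ++ X :: B₂ → E = C₁ ++ X :: C₂ → Γ = C₁ ++ (A ++ C₂) → Δ = B₁ ++ (D ++ B₂) →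
    Hom E D → Hom A B → Hom Γ Δ
  comp_id : ∀ {D : List C} (C₁ C₂ : List C) (X : C) (l : Hom (C₁ ++ X :: C₂) D),
    comp [] [] C₁ C₂ X rfl rfl (by simp) (by simp) l (id X) = l
  id_comp : ∀ {A : List C} (B₁ B₂ : List C) (X : C) (k : Hom A (B₁ ++ X :: B₂)),
    comp B₁ B₂ [] [] X rfl rfl (by simp) (by simp) (id X) k = k
  assoc : ∀ {A F : List C} (B₁ B₂ C₁ C₂ D₁ D₂ E₁ E₂ : List C) (X Y : C)
    (k : Hom A (B₁ ++ X :: B₂)) (l : Hom (C₁ ++ X :: C₂) (D₁ ++ Y :: D₂))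
    (h : Hom (E₁ ++ Y :: E₂) F),
    comp (Γ := E₁ ++ C₁ ++ A ++ C₂ ++ E₂) (Δ := B₁ ++ D₁ ++ F ++ D₂ ++ B₂)
        (B₁ ++ D₁) (D₂ ++ B₂) E₁ E₂ Y (by simp) rfl (by simp) (by simp)
        h (comp B₁ B₂ C₁ C₂ X rfl rfl rfl rfl l k) =
      comp B₁ B₂ (E₁ ++ C₁) (C₂ ++ E₂) X rfl (by simp) (by simp) (by simp)
        (comp D₁ D₂ E₁ E₂ Y rfl rfl rfl rfl h l) k
  interchange_out : ∀ {A D F : List C} (B₁ B₂ B₃ C₁ C₂ E₁ E₂ : List C) (X Y : C)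
    (hl : C₁ = [] ∨ E₁ = []) (hr : C₂ = [] ∨ E₂ = [])
    (k : Hom A (B₁ ++ X :: (B₂ ++ Y :: B₃))) (l : Hom (C₁ ++ X :: C₂) D)
    (h : Hom (E₁ ++ Y :: E₂) F),
    comp (Γ := E₁ ++ C₁ ++ A ++ C₂ ++ E₂) (Δ := B₁ ++ D ++ B₂ ++ F ++ B₃)
        (B₁ ++ D ++ B₂) B₃ E₁ E₂ Y (by simp) rfl (by simp) (by simp)
        h (comp B₁ (B₂ ++ Y :: B₃) C₁ C₂ X rfl rfl rfl rfl l k) =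
      comp B₁ (B₂ ++ F ++ B₃) C₁ C₂ X (by simp) rfl
        (by rcases hl with rfl | rfl <;> rcases hr with rfl | rfl <;> simp) (by simp)
        l (comp (B₁ ++ X :: B₂) B₃ E₁ E₂ Y (by simp) rfl rfl rfl h k)
  interchange_in : ∀ {A D F : List C} (C₁ C₂ C₃ B₁ B₂ E₁ E₂ : List C) (X Y : C)
    (hl : B₁ = [] ∨ E₁ = []) (hr : B₂ = [] ∨ E₂ = [])
    (l : Hom (C₁ ++ X :: (C₂ ++ Y :: C₃)) D) (k : Hom A (B₁ ++ X :: B₂))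
    (h : Hom F (E₁ ++ Y :: E₂)),
    comp (Γ := C₁ ++ A ++ C₂ ++ F ++ C₃) (Δ := E₁ ++ B₁ ++ D ++ B₂ ++ E₂)
        E₁ E₂ (C₁ ++ A ++ C₂) C₃ Y rfl (by simp) (by simp) (by simp)
        (comp B₁ B₂ C₁ (C₂ ++ Y :: C₃) X rfl rfl rfl rfl l k) h =
      comp B₁ B₂ C₁ (C₂ ++ F ++ C₃) X rfl (by simp) (by simp)
        (by rcases hl with rfl | rfl <;> rcases hr with rfl | rfl <;> simp)
        (comp E₁ E₂ (C₁ ++ X :: C₂) C₃ Y rfl (by simp) rfl rfl l h) k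

/-- A color system: a category `K` of object colors, an ordered polycategory `M` of morphism
colors on the objects of `K`, and a functorial assignment `ι` of a unary morphism color to every
morphism of `K`. -/
structure ColorSystem (K : Type u₁) [Category.{u₂} K] where
  M : OrderedPolycategory.{u₁, u₃} K
  ι : ∀ {c d : K}, (c ⟶ d) → M.Hom [c] [d]
  ι_id : ∀ c : K, ι (𝟙 c) = M.id c
  ι_comp : ∀ {c d e : K} (f : c ⟶ d) (g : d ⟶ e),
    ι (f ≫ g) = M.comp [] [] [] [] d rfl rfl rfl rfl (ι g) (ι f)

/-- A colored Markov polycategory (CMP) over a color system: a Markov polycategory with object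
colors `χ`, morphism colors `ψ` (preserving identities and slotwise composition) and an interface
system, that is, sets `Int B C` of admissible witnesses, containing identities and closed under
composition, together with interface kernels `κ f : (B) ⟶ (C)` of morphism color `ι f` that
depend functorially on the witness. -/
structure CMP {K : Type u₃} [Category.{u₄} K] (CS : ColorSystem.{u₃, u₄, u₅} K)
    extends MarkovPolycategory.{u₁, u₂} where
  χ : Ob → K
  ψ : ∀ {A B : List Ob}, Hom A B → CS.M.Hom (A.map χ) (B.map χ)
  ψ_id : ∀ X : Ob, ψ ⟨Kernel.id, id_mem X⟩ = CS.M.id (χ X)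
  ψ_ksc : ∀ {A D : List Ob} (B₁ B₂ C₁ C₂ : List Ob) (X : Ob)
    (l : Hom (C₁ ++ X :: C₂) D) (k : Hom A (B₁ ++ X :: B₂)),
    ψ ⟨ksc B₁ B₂ C₁ C₂ X l.1 k.1, ksc_mem B₁ B₂ C₁ C₂ X l.2 k.2⟩ =
      CS.M.comp (B₁.map χ) (B₂.map χ) (C₁.map χ) (C₂.map χ) (χ X)
        (by simp) (by simp) (by simp) (by simp) (ψ l) (ψ k)
  Int : (B C : Ob) → Set (χ B ⟶ χ C)
  κ : ∀ {B C : Ob}, Int B C → Hom [B] [C]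
  ψ_κ : ∀ {B C : Ob} (f : Int B C), ψ (κ f) = CS.ι f.1
  int_id : ∀ B : Ob, 𝟙 (χ B) ∈ Int B B
  κ_id : ∀ B : Ob, (κ ⟨𝟙 (χ B), int_id B⟩).1 = Kernel.id
  int_comp : ∀ {B C D : Ob} {f : χ B ⟶ χ C} {g : χ C ⟶ χ D},
    f ∈ Int B C → g ∈ Int C D → f ≫ g ∈ Int B D
  κ_comp : ∀ {B C D : Ob} (f : Int B C) (g : Int C D),
    (κ ⟨f.1 ≫ g.1, int_comp f.2 g.2⟩).1 = (κ g).1 ∘ₖ (κ f).1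

/-! ## Finite acyclic CKSC diagrams -/

section Diagrams

variable {K : Type u₃} [Category.{u₄} K] {CS : ColorSystem.{u₃, u₄, u₅} K}

/-- The shape of a finite acyclic CKSC diagram: everything except the kernels at the vertices. -/
structure DiagramShape (P : CMP.{u₁, u₂, u₃, u₄, u₅} CS) where
  V : Type u₆
  [finiteV : Finite V]
  inp : V → List P.Ob
  out : V → List P.Ob
  W : Type u₇
  [finiteW : Finite W]
  src : W → (u : V) × Fin (out u).length
  tgt : W → (v : V) × Fin (inp v).length
  wit : (e : W) →
    P.Int ((out (src e).1).get (src e).2) ((inp (tgt e).1).get (tgt e).2)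
  src_injective : Function.Injective src
  tgt_injective : Function.Injective tgt
  acyclic : ∀ v : V, ¬ Relation.TransGen (fun a b => ∃ e, (src e).1 = a ∧ (tgt e).1 = b) v v
  extIn : List ((v : V) × Fin (inp v).length)
  extIn_nodup : extIn.Nodup
  mem_extIn : ∀ s, s ∈ extIn ↔ s ∉ Set.range tgt
  extOut : List ((u : V) × Fin (out u).length)
  extOut_nodup : extOut.Nodup
  mem_extOut : ∀ s, s ∈ extOut ↔ s ∉ Set.range src

attribute [instance] DiagramShape.finiteV DiagramShape.finiteW

namespace DiagramShape

variable {P : CMP.{u₁, u₂, u₃, u₄, u₅} CS} (D : DiagramShape.{u₁, u₂, u₃, u₄, u₅, u₆, u₇} P)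

/-- Object at an input slot. -/
abbrev inObj (s : (v : D.V) × Fin (D.inp v).length) : P.Ob := (D.inp s.1).get s.2

/-- Object at an output slot. -/
abbrev outObj (s : (u : D.V) × Fin (D.out u).length) : P.Ob := (D.out s.1).get s.2

/-- External input profile. -/
abbrev inProfile : List P.Ob := D.extIn.map D.inObj

/-- External output profile. -/
abbrev outProfile : List P.Ob := D.extOut.map D.outObj

/-- A labelling of the vertices by morphisms.  A finite acyclic CKSC diagram is a shape together
with a labelling. -/
abbrev Labelling := (u : D.V) → P.Hom (D.inp u) (D.out u)

/-- Vertices of the interface expansion: the original vertices, and one unary interface vertex for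
every internal wire. -/
abbrev Node := D.V ⊕ D.W

/-- Input profile of a vertex of the interface expansion. -/
abbrev nodeIn : D.Node → List P.Ob
  | .inl u => D.inp u
  | .inr e => [D.outObj (D.src e)]

/-- Output profile of a vertex of the interface expansion. -/
abbrev nodeOut : D.Node → List P.Ob
  | .inl u => D.out u
  | .inr e => [D.inObj (D.tgt e)]

/-- The kernel at a vertex of the interface expansion. -/
def nodeKernel (k : D.Labelling) :
    (n : D.Node) → Kernel (P.Space (D.nodeIn n)) (P.Space (D.nodeOut n))
  | .inl u => (k u).1
  | .inr e => (P.κ (D.wit e)).1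

/-- `D.Pred m n`: in the interface expansion some wire goes from `m` to `n`. -/
def Pred : D.Node → D.Node → Prop
  | .inl u, .inr e => (D.src e).1 = u
  | .inr e, .inl v => (D.tgt e).1 = v
  | _, _ => False

open Classical in
/-- The input tuple of a vertex of the interface expansion, as a function of the external input
`x` and of the output tuples `y` of its direct predecessors. -/
def nodeInput : (n : D.Node) → P.Space D.inProfile →
    ((m : {m // D.Pred m n}) → P.Space (D.nodeOut m.1)) → P.Space (D.nodeIn n)
  | .inl v, x, y => fun q =>
    if h : ∃ e, D.tgt e = ⟨v, q⟩ then
      cast (congrArg (fun s => P.carrier (D.inObj s)) h.choose_spec)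
        (Val.head (y ⟨.inr h.choose, congrArg Sigma.fst h.choose_spec⟩))
    else
      Val.lookup D.inObj ⟨v, q⟩ D.extIn ((D.mem_extIn _).2 h) x
  | .inr e, _, y => Val.single (y ⟨.inl (D.src e).1, rfl⟩ (D.src e).2)

theorem measurable_nodeInput (n : D.Node) :
    Measurable fun p : P.Space D.inProfile ×
      ((m : {m // D.Pred m n}) → P.Space (D.nodeOut m.1)) => D.nodeInput n p.1 p.2 := by
  have hcast : ∀ {s t : (v : D.V) × Fin (D.inp v).length} (h : s = t),
      Measurable (cast (congrArg (fun s => P.carrier (D.inObj s)) h)) := by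
    rintro s t rfl; exact measurable_id
  cases n with
  | inl v =>
    refine measurable_pi_iff.2 fun q => ?_
    by_cases h : ∃ e, D.tgt e = ⟨v, q⟩
    · simp only [nodeInput, dif_pos h]
      exact (hcast h.choose_spec).comp
        (Val.measurable_head.comp ((measurable_pi_apply _).comp measurable_snd))
    · simp only [nodeInput, dif_neg h]
      exact (Val.measurable_lookup D.inObj _ _ _).comp measurable_fst
  | inr e =>
    exact Val.measurable_single.comp
      ((measurable_pi_apply _).comp ((measurable_pi_apply _).comp measurable_snd))

/-- Lists of distinct vertices of the interface expansion, latest vertex first, in which all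
direct predecessors of every listed vertex stand further down the list. -/
def IsTopological : List D.Node → Prop
  | [] => True
  | n :: T => n ∉ T ∧ (∀ m, D.Pred m n → m ∈ T) ∧ IsTopological T

/-- Topological orderings of the vertices of the interface expansion. -/
structure TopologicalOrder where
  order : List D.Node
  isTopological : D.IsTopological order
  mem_order : ∀ n, n ∈ order

theorem wellFounded_pred : WellFounded D.Pred := by
  have hV : WellFounded (Relation.TransGen
      (fun a b => ∃ e, (D.src e).1 = a ∧ (D.tgt e).1 = b)) :=
    have : Std.Irrefl (Relation.TransGen
      (fun a b => ∃ e, (D.src e).1 = a ∧ (D.tgt e).1 = b)) := ⟨D.acyclic⟩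
    Finite.wellFounded_of_trans_of_irrefl _
  have hl : ∀ v : D.V, Acc D.Pred (.inl v) := by
    intro v
    induction v using hV.induction with
    | _ v ih =>
      refine Acc.intro _ fun m hm => ?_
      rcases m with u | e
      · exact hm.elim
      · refine Acc.intro _ fun m' hm' => ?_
        rcases m' with u | e'
        · exact ih u (Relation.TransGen.single ⟨e, hm', hm⟩)
        · exact hm'.elim
  refine ⟨fun n => ?_⟩
  rcases n with v | e
  · exact hl v
  · refine Acc.intro _ fun m hm => ?_
    rcases m with u | e'
    · exact hl u
    · exact hm.elim

theorem IsTopological.nodup : ∀ {L : List D.Node}, D.IsTopological L → L.Nodup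
  | [], _ => List.nodup_nil
  | _ :: _, h => List.nodup_cons.2 ⟨h.1, h.2.2.nodup⟩

instance : Nonempty D.TopologicalOrder := by
  classical
  have := Fintype.ofFinite D.Node
  have key : ∀ j : ℕ, j ≤ Fintype.card D.Node →
      ∃ L, D.IsTopological L ∧ L.length = j := by
    intro j
    induction j with
    | zero => exact fun _ => ⟨[], trivial, rfl⟩
    | succ j ih =>
      intro hj
      obtain ⟨L, hL, hlen⟩ := ih (by omega)
      have hne : {n : D.Node | n ∉ L}.Nonempty := by
        by_contra hcon
        have hall : ∀ n, n ∈ L := by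
          intro n; by_contra hn; exact hcon ⟨n, hn⟩
        have h1 : (Finset.univ : Finset D.Node).card ≤ L.toFinset.card :=
          Finset.card_le_card fun n _ => by simpa using hall n
        have h2 := L.toFinset_card_le
        rw [Finset.card_univ] at h1
        omega
      refine ⟨D.wellFounded_pred.min _ hne :: L, ⟨D.wellFounded_pred.min_mem _ hne, ?_, hL⟩,
        by simp [hlen]⟩
      intro m hm
      by_contra hmL
      exact D.wellFounded_pred.not_lt_min {n : D.Node | n ∉ L} hmL hm
  obtain ⟨L, hL, hlen⟩ := key _ le_rfl
  refine ⟨⟨L, hL, fun n => ?_⟩⟩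
  have h1 : L.toFinset = Finset.univ := by
    rw [← Finset.card_eq_iff_eq_univ, List.toFinset_card_of_nodup hL.nodup, hlen]
  exact List.mem_toFinset.1 (h1.symm ▸ Finset.mem_univ n : n ∈ L.toFinset)

/-- Output tuples of the vertices in a list. -/
abbrev PartialTrace (L : List D.Node) := (m : {m // m ∈ L}) → P.Space (D.nodeOut m.1)

open Classical in
/-- Extend a partial trace by the output tuple of one more vertex. -/
def extend (n : D.Node) (T : List D.Node) (q : D.PartialTrace T × P.Space (D.nodeOut n)) :
    D.PartialTrace (n :: T) := fun m =>
  if h : n = m.1 then h ▸ q.2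
  else q.1 ⟨m.1, (List.mem_cons.1 m.2).resolve_left fun h' => h h'.symm⟩

/-- The trace kernel along a topologically sorted list: the vertices are evaluated one after the
other, `μ(dy, dy_n ∣ x) = k_n(dy_n ∣ input_n(x, y)) μ(dy ∣ x)`. -/
def traceAlong (k : D.Labelling) : (L : List D.Node) → D.IsTopological L →
    Kernel (P.Space D.inProfile) (D.PartialTrace L)
  | [], _ => Kernel.deterministic
      (fun _ m => absurd m.2 (by simp)) measurable_const
  | n :: T, h =>
    ((traceAlong k T h.2.2) ⊗ₖ
      ((D.nodeKernel k n).comap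
        (fun p : P.Space D.inProfile × D.PartialTrace T =>
          D.nodeInput n p.1 fun m => p.2 ⟨m.1, h.2.1 m.1 m.2⟩)
        ((D.measurable_nodeInput n).comp
          (measurable_fst.prodMk (measurable_pi_iff.2 fun m =>
            (measurable_pi_apply (⟨m.1, h.2.1 m.1 m.2⟩ : {m // m ∈ T})).comp
              measurable_snd))))).map (D.extend n T)

/-- The trace measure of the interface expansion, conditional on the external input, on the
labelled product of the output spaces of all vertices of the interface expansion. -/
def traceMeasure (τ : D.TopologicalOrder) (k : D.Labelling) :
    Kernel (P.Space D.inProfile) ((n : D.Node) → P.Space (D.nodeOut n)) :=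
  (D.traceAlong k τ.order τ.isTopological).map fun y n => y ⟨n, τ.mem_order n⟩

/-- The external output projection. -/
def extOutput (y : (n : D.Node) → P.Space (D.nodeOut n)) : P.Space D.outProfile :=
  Val.ofList D.outObj D.extOut fun s => y (.inl s.1) s.2

/-- The Markov kernel `K_D` from external inputs to external outputs denoted by a diagram. -/
def traceKernel (τ : D.TopologicalOrder) (k : D.Labelling) :
    Kernel (P.Space D.inProfile) (P.Space D.outProfile) :=
  (D.traceMeasure τ k).map D.extOutput

/-- The space of full traces: external input, reference value, and the output tuples of all
vertices of the interface expansion. -/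
abbrev TraceSpace (R : List P.Ob) :=
  (P.Space D.inProfile × P.Space R) × ((n : D.Node) → P.Space (D.nodeOut n))

/-- The random input tuple of the vertex `u`. -/
def inputVar (R : List P.Ob) (u : D.V) (ω : D.TraceSpace R) : P.Space (D.inp u) :=
  D.nodeInput (.inl u) ω.1.1 fun m => ω.2 m.1

/-- The random output tuple of the vertex `u`. -/
def outputVar (R : List P.Ob) (u : D.V) (ω : D.TraceSpace R) : P.Space (D.out u) :=
  ω.2 (.inl u)

end DiagramShape

/-! ## Parameterized diagrams and expected objectives -/

/-- A jointly measurable parameterized kernel of constant morphism color.  The parameter space is a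
finite-dimensional real vector space; the choice of norm plays no role. -/
structure ParameterizedKernel (P : CMP.{u₁, u₂, u₃, u₄, u₅} CS) (A B : List P.Ob) (Θ : Type u₆)
    [MeasurableSpace Θ] where
  hom : Θ → P.Hom A B
  measurable_hom : ∀ E : Set (P.Space B), MeasurableSet E →
    Measurable fun p : Θ × P.Space A => (hom p.1).1 p.2 E
  constant_color : ∃ m, ∀ θ, P.ψ (hom θ) = m

/-- A parameterized CKSC diagram.  The vertices in `par` carry a parameter space and a parameterized
kernel, the other vertices carry a fixed morphism. -/
structure ParameterizedDiagram (P : CMP.{u₁, u₂, u₃, u₄, u₅} CS)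
    extends DiagramShape.{u₁, u₂, u₃, u₄, u₅, u₆, u₇} P where
  par : Set V
  Θ : par → Type u₈
  [normed : ∀ u, NormedAddCommGroup (Θ u)]
  [normedSpace : ∀ u, NormedSpace ℝ (Θ u)]
  [finiteDimensional : ∀ u, FiniteDimensional ℝ (Θ u)]
  [measurableΘ : ∀ u, MeasurableSpace (Θ u)]
  [borelΘ : ∀ u, BorelSpace (Θ u)]
  kernel : (u : par) → ParameterizedKernel P (inp u.1) (out u.1) (Θ u)
  fixed : (u : V) → u ∉ par → P.Hom (inp u) (out u)

attribute [instance] ParameterizedDiagram.normed ParameterizedDiagram.normedSpace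
  ParameterizedDiagram.finiteDimensional ParameterizedDiagram.measurableΘ
  ParameterizedDiagram.borelΘ

namespace ParameterizedDiagram

variable {P : CMP.{u₁, u₂, u₃, u₄, u₅} CS}
  (D : ParameterizedDiagram.{u₁, u₂, u₃, u₄, u₅, u₆, u₇, u₈} P)

instance : Fintype D.par := Fintype.ofFinite _

instance : DecidableEq D.par := Classical.decEq _

/-- The total parameter space. -/
abbrev Params := (u : D.par) → D.Θ u

open Classical in
/-- The labelling of the instantiated diagram at the parameter `θ`. -/
def labelling (θ : D.Params) : D.Labelling := fun u =>
  if h : u ∈ D.par then (D.kernel ⟨u, h⟩).hom (θ ⟨u, h⟩) else D.fixed u h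

/-- The expected objective
`L_D(θ) = ∫ (∫ f(y, r) K_D^θ(dy ∣ x)) ρ(dx, dr)`. -/
def expectedObjective (τ : D.TopologicalOrder) {R : List P.Ob}
    (ρ : Measure (P.Space D.inProfile × P.Space R)) (f : P.Space D.outProfile × P.Space R → ℝ)
    (θ : D.Params) : ℝ :=
  ∫ p, (∫ y, f (y, p.2) ∂(D.traceKernel τ (D.labelling θ) p.1)) ∂ρ

/-- The full trace law `ν_D^θ(dx, dr, dy) = ρ(dx, dr) μ^θ(dy ∣ x)`. -/
def traceLaw (τ : D.TopologicalOrder) {R : List P.Ob}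
    (ρ : Measure (P.Space D.inProfile × P.Space R)) (θ : D.Params) : Measure (D.TraceSpace R) :=
  ρ ⊗ₘ ((D.traceMeasure τ (D.labelling θ)).prodMkRight (P.Space R))

/-- The scalar random objective `J`. -/
def objective {R : List P.Ob} (f : P.Space D.outProfile × P.Space R → ℝ)
    (ω : D.TraceSpace R) : ℝ :=
  f (D.extOutput ω.2, ω.1.2)

/-- The random triple of the input of `u`, the output of `u` and a context variable. -/
def localVar {R : List P.Ob} (u : D.par) {S : Type*} (ctx : D.TraceSpace R → S)
    (ω : D.TraceSpace R) : P.Space (D.inp u.1) × P.Space (D.out u.1) × S :=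
  (D.inputVar R u.1 ω, D.outputVar R u.1 ω, ctx ω)

/-- `ctx` is an admissible local context for the parameterized vertex `u`: for all values of the
parameters at the other vertices there is a probability measure `lam` on pairs (input, context),
independent of the parameter `t` at `u`, such that the joint law of input, output and context is
`k_t(db ∣ a) lam(da, ds)`. -/
def IsAdmissibleContext (τ : D.TopologicalOrder) {R : List P.Ob}
    (ρ : Measure (P.Space D.inProfile × P.Space R)) (u : D.par) {S : Type*} [MeasurableSpace S]
    (ctx : D.TraceSpace R → S) : Prop :=
  Measurable ctx ∧
  ∀ θ : D.Params, ∃ lam : Measure (P.Space (D.inp u.1) × S), IsProbabilityMeasure lam ∧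
    ∀ t : D.Θ u, ∀ φ : P.Space (D.inp u.1) × P.Space (D.out u.1) × S → ℝ, Measurable φ →
      (∃ c, ∀ z, |φ z| ≤ c) →
      ∫ ω, φ (D.localVar u ctx ω) ∂(D.traceLaw τ ρ (Function.update θ u t)) =
        ∫ p, (∫ b, φ (p.1, b, p.2) ∂(((D.kernel u).hom t).1 p.1)) ∂lam

end ParameterizedDiagram

/-- `Q` is a conditional expected future objective for the random variable `Z` under the law `ν`:
it is measurable and `Q(Z)` is a version of the conditional expectation of `J` given `Z`. -/
def IsConditionalFutureObjective {Ω : Type*} [MeasurableSpace Ω] (ν : Measure Ω) (J : Ω → ℝ)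
    {E : Type*} [MeasurableSpace E] (Z : Ω → E) (Q : E → ℝ) : Prop :=
  Measurable Q ∧ (fun ω => Q (Z ω)) =ᵐ[ν] ν[J | MeasurableSpace.comap Z inferInstance]

/-- An admissible local parameter-gradient operator for a parameterized kernel, relative to a
context space `S` and a class `cls` of measurable functions.  The requirement applies to every
probability measure `lam` and every parameter `θ` such that the integral defining `F_Q` converges
absolutely near `θ`, `F_Q` is differentiable at `θ`, and the integral of the gradient function
converges absolutely. -/
structure AdmissibleGradientOperator {P : CMP.{u₁, u₂, u₃, u₄, u₅} CS} {A B : List P.Ob}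
    {Θ : Type u₆} [NormedAddCommGroup Θ] [NormedSpace ℝ Θ] [MeasurableSpace Θ]
    (k : ParameterizedKernel P A B Θ) (S : Type u₇) [MeasurableSpace S] where
  cls : Set (P.Space A × P.Space B × S → ℝ)
  measurable_cls : ∀ Q ∈ cls, Measurable Q
  grad : cls → Θ × P.Space A × P.Space B × S → (Θ →L[ℝ] ℝ)
  measurable_grad : ∀ Q, Measurable (grad Q)
  hasFDerivAt : ∀ (Q : cls) (lam : Measure (P.Space A × S)) [IsProbabilityMeasure lam] (θ : Θ),
    (∀ᶠ θ' in 𝓝 θ, Integrable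
      (fun z : (P.Space A × S) × P.Space B => Q.1 (z.1.1, z.2, z.1.2))
      (lam ⊗ₘ ((k.hom θ').1.prodMkRight S))) →
    DifferentiableAt ℝ
      (fun θ' => ∫ p, (∫ b, Q.1 (p.1, b, p.2) ∂((k.hom θ').1 p.1)) ∂lam) θ →
    Integrable
      (fun z : (P.Space A × S) × P.Space B => grad Q (θ, z.1.1, z.2, z.1.2))
      (lam ⊗ₘ ((k.hom θ).1.prodMkRight S)) →
    HasFDerivAt
      (fun θ' => ∫ p, (∫ b, Q.1 (p.1, b, p.2) ∂((k.hom θ').1 p.1)) ∂lam)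
      (∫ p, (∫ b, grad Q (θ, p.1, b, p.2) ∂((k.hom θ).1 p.1)) ∂lam) θ

end Diagrams

end

/-! Since the objective is assumed differentiable at `θ`, its derivative is determined by its
restrictions to the factors `Θ u`, so the argument varies one parameter `t` at a time. Reverse-mode
differentiation then rests on an identity of functions of `t`, not on a chain rule through the
graph.

Fix `u`. By the tower property, the expectation of `J` equals that of `Q(Z)`, where `Z` collects the
input, output and context of `u`. Admissibility of the context says that the law of `Z` is `k_t(db ∣
a) lam(da, ds)` with `lam` free of `t`. Hence for all `t` near `θ u` the objective equals `F_Q(t)`,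
in which `t` enters only through the local kernel. The gradient operator differentiates `F_Q` as an
integral over `lam` and the kernel, and the same description of the law of `Z` turns that integral
back into an expectation under the trace law.

The two transfers are carried by `map_eq_map_compProd_of_integral_eq` and
`integrable_and_integral_eq_of_map_eq`; the partial derivative is
`hasFDerivAt_expectedObjective_update`. The diagram matters only through measurability of its trace
variables and the total mass of its trace law; no property of the chosen topological order is needed
beyond what defines the trace. -/

namespace Val

/-! ### Measurability of trace variables and total mass of the trace kernel -/

theorem measurable_ofList {Ob : Type*} {carrier : Ob → Type*} [∀ X, MeasurableSpace (carrier X)]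
    {ι : Type*} (obj : ι → Ob) (L : List ι) :
    Measurable (ofList obj L : ((s : ι) → carrier (obj s)) → Val carrier (L.map obj)) := by
  induction L with
  | nil => exact measurable_const
  | cons s L ih =>
    exact (measurable_cons (X := obj s) (A := L.map obj)).comp
      (Measurable.prodMk (f := fun y : (s : ι) → carrier (obj s) => y s) (measurable_pi_apply s) ih)

end Val

namespace DiagramShape

variable {K : Type*} [Category K] {CS : ColorSystem K} {P : CMP CS} (D : DiagramShape P)

theorem measurable_extOutput : Measurable D.extOutput :=
  (Val.measurable_ofList D.outObj D.extOut).comp <| measurable_pi_iff.2 fun s =>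
    (measurable_pi_apply s.2).comp (measurable_pi_apply (Sum.inl s.1 : D.Node))

theorem measurable_inputVar (R : List P.Ob) (u : D.V) : Measurable (D.inputVar R u) :=
  (D.measurable_nodeInput (.inl u)).comp <|
    (measurable_fst.comp measurable_fst).prodMk <| measurable_pi_iff.2 fun m =>
      (measurable_pi_apply m.1).comp measurable_snd

theorem measurable_outputVar (R : List P.Ob) (u : D.V) : Measurable (D.outputVar R u) :=
  (measurable_pi_apply (Sum.inl u : D.Node)).comp measurable_snd

open Classical in
theorem measurable_extend (n : D.Node) (T : List D.Node) : Measurable (D.extend n T) := by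
  refine measurable_pi_iff.2 fun ⟨m, hm⟩ => ?_
  by_cases h : n = m
  · subst h
    simpa only [extend, dite_true] using measurable_snd
  · simp only [extend, dif_neg h]
    exact (measurable_pi_apply _).comp measurable_fst

instance isMarkovKernel_nodeKernel (k : D.Labelling) (n : D.Node) :
    IsMarkovKernel (D.nodeKernel k n) := by
  cases n with
  | inl u => exact P.isMarkov (k u).2
  | inr e => exact P.isMarkov (P.κ (D.wit e)).2

/-- A composition product of Markov kernels is Markov, and appending one vertex preserves mass
because `extend` is measurable; `Kernel.map` along a non-measurable function would be the zero
kernel. -/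
theorem isMarkovKernel_traceAlong (k : D.Labelling) :
    ∀ (L : List D.Node) (h : D.IsTopological L), IsMarkovKernel (D.traceAlong k L h)
  | [], _ => by
    unfold traceAlong
    infer_instance
  | n :: T, h => by
    have := isMarkovKernel_traceAlong k T h.2.2
    unfold traceAlong
    exact Kernel.IsMarkovKernel.map _ (D.measurable_extend n T)

instance isMarkovKernel_traceMeasure (τ : D.TopologicalOrder) (k : D.Labelling) :
    IsMarkovKernel (D.traceMeasure τ k) := by
  have := D.isMarkovKernel_traceAlong k τ.order τ.isTopological
  exact Kernel.IsMarkovKernel.map _ (measurable_pi_iff.2 fun n => measurable_pi_apply _)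

end DiagramShape

/-! ### Conditional expectations and the law of the local variables -/

/-- A conditional future objective has the same expectation as the objective, and is integrable. -/
theorem IsConditionalFutureObjective.integrable_and_integral_eq {Ω E : Type*} [MeasurableSpace Ω]
    [MeasurableSpace E] {ν : Measure Ω} [IsFiniteMeasure ν] {J : Ω → ℝ} {Z : Ω → E} {Q : E → ℝ}
    (h : IsConditionalFutureObjective ν J Z Q) (hZ : Measurable Z) :
    Integrable (fun ω => Q (Z ω)) ν ∧ ∫ ω, Q (Z ω) ∂ν = ∫ ω, J ω ∂ν :=
  -- Integrability of `J` is not needed here: if it fails, the conditional expectation and the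
  -- Bochner integral of `J` are both zero by convention.
  ⟨integrable_condExp.congr h.2.symm,
    (integral_congr_ae h.2).trans (integral_condExp hZ.comap_le)⟩

/-- If the expectations of bounded measurable functions of `Z` are iterated integrals against a
measure and a kernel, then the law of `Z` is the corresponding composition product. -/
theorem map_eq_map_compProd_of_integral_eq {Ω A B S : Type*} [MeasurableSpace Ω]
    [MeasurableSpace A] [MeasurableSpace B] [MeasurableSpace S]
    {ν : Measure Ω} [IsFiniteMeasure ν] {Z : Ω → A × B × S} (hZ : Measurable Z)
    {lam : Measure (A × S)} [IsFiniteMeasure lam] {k : Kernel A B} [IsMarkovKernel k]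
    (h : ∀ φ : A × B × S → ℝ, Measurable φ → (∃ c, ∀ z, |φ z| ≤ c) →
      ∫ ω, φ (Z ω) ∂ν = ∫ p, (∫ b, φ (p.1, b, p.2) ∂(k p.1)) ∂lam) :
    ν.map Z = (lam ⊗ₘ (k.prodMkRight S)).map fun z => (z.1.1, z.2, z.1.2) := by
  have hg : Measurable fun z : (A × S) × B => (z.1.1, z.2, z.1.2) := by fun_prop
  ext s hs
  -- Both measures are finite, so real-valued masses suffice, and these are integrals of indicators,
  -- to which `h` applies with bound `1`.
  rw [← measureReal_eq_measureReal_iff]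
  have hφ : Measurable (s.indicator (1 : A × B × S → ℝ)) := measurable_one.indicator hs
  have hb : ∀ z, |s.indicator (1 : A × B × S → ℝ) z| ≤ 1 := fun z => by
    by_cases hz : z ∈ s <;> simp [hz]
  rw [← integral_indicator_one hs, ← integral_indicator_one hs,
    integral_map hZ.aemeasurable hφ.aestronglyMeasurable,
    integral_map hg.aemeasurable hφ.aestronglyMeasurable, h _ hφ ⟨1, hb⟩,
    Measure.integral_compProd]
  · rfl
  · exact Integrable.of_bound (hφ.comp hg).aestronglyMeasurable 1 (ae_of_all _ fun z => hb _)

/-- Transfer of integrability and of the integral along an equality of laws. -/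
theorem integrable_and_integral_eq_of_map_eq {Ω A B S F : Type*} [MeasurableSpace Ω]
    [MeasurableSpace A] [MeasurableSpace B] [MeasurableSpace S]
    [NormedAddCommGroup F] [NormedSpace ℝ F]
    {ν : Measure Ω} {Z : Ω → A × B × S} (hZ : Measurable Z)
    {lam : Measure (A × S)} [SFinite lam] {k : Kernel A B} [IsSFiniteKernel k]
    (h : ν.map Z = (lam ⊗ₘ (k.prodMkRight S)).map fun z => (z.1.1, z.2, z.1.2))
    {g : A × B × S → F} (hg : StronglyMeasurable g) (hi : Integrable (fun ω => g (Z ω)) ν) :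
    Integrable (fun z : (A × S) × B => g (z.1.1, z.2, z.1.2)) (lam ⊗ₘ (k.prodMkRight S)) ∧
      ∫ ω, g (Z ω) ∂ν = ∫ p, (∫ b, g (p.1, b, p.2) ∂(k p.1)) ∂lam := by
  have hr : Measurable fun z : (A × S) × B => (z.1.1, z.2, z.1.2) := by fun_prop
  have hi' : Integrable (fun z : (A × S) × B => g (z.1.1, z.2, z.1.2))
      (lam ⊗ₘ (k.prodMkRight S)) := by
    -- Integrability depends only on the law: it passes from `ν` to the common image measure and
    -- down to the composition product.
    refine (integrable_map_measure hg.aestronglyMeasurable hr.aemeasurable).1 ?_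
    rw [← h]
    exact (integrable_map_measure hg.aestronglyMeasurable hZ.aemeasurable).2 hi
  refine ⟨hi', ?_⟩
  rw [← integral_map hZ.aemeasurable hg.aestronglyMeasurable, h,
    integral_map hr.aemeasurable hg.aestronglyMeasurable, Measure.integral_compProd hi']
  rfl

/-! ### Partial and total derivatives of the expected objective -/

namespace ParameterizedDiagram

variable {K : Type*} [Category K] {CS : ColorSystem K} {P : CMP CS} (D : ParameterizedDiagram P)

/-- Finiteness is what the tower property and the identification of laws by bounded test functions
require. -/
instance isProbabilityMeasure_traceLaw (τ : D.TopologicalOrder) {R : List P.Ob}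
    (ρ : Measure (P.Space D.inProfile × P.Space R)) [IsProbabilityMeasure ρ] (θ : D.Params) :
    IsProbabilityMeasure (D.traceLaw τ ρ θ) := by
  unfold traceLaw
  infer_instance

theorem measurable_localVar {R : List P.Ob} (u : D.par) {S : Type*} [MeasurableSpace S]
    {ctx : D.TraceSpace R → S} (hctx : Measurable ctx) : Measurable (D.localVar u ctx) :=
  (D.measurable_inputVar R u.1).prodMk ((D.measurable_outputVar R u.1).prodMk hctx)

/-- The expected objective is the expectation of the random objective under the trace law. -/
theorem expectedObjective_eq_integral (τ : D.TopologicalOrder) {R : List P.Ob}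
    (ρ : Measure (P.Space D.inProfile × P.Space R)) [IsProbabilityMeasure ρ]
    {f : P.Space D.outProfile × P.Space R → ℝ} (hf : Measurable f) {θ : D.Params}
    (hJ : Integrable (D.objective f) (D.traceLaw τ ρ θ)) :
    D.expectedObjective τ ρ f θ = ∫ ω, D.objective f ω ∂(D.traceLaw τ ρ θ) := by
  unfold traceLaw at hJ ⊢
  rw [Measure.integral_compProd hJ]
  -- For each external input and reference value, the output kernel is the image of the trace kernel
  -- under `extOutput`, so the inner integrals agree by change of variables.
  refine integral_congr_ae (ae_of_all _ fun p => ?_)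
  simp only [DiagramShape.traceKernel, Kernel.map_apply _ D.measurable_extOutput,
    Kernel.prodMkRight_apply]
  exact integral_map D.measurable_extOutput.aemeasurable
    (hf.comp (measurable_id.prodMk measurable_const)).aestronglyMeasurable

/-- The partial derivative of the expected objective at a parameterized vertex. -/
theorem hasFDerivAt_expectedObjective_update (τ : D.TopologicalOrder) {R : List P.Ob}
    (ρ : Measure (P.Space D.inProfile × P.Space R)) [IsProbabilityMeasure ρ]
    {f : P.Space D.outProfile × P.Space R → ℝ} (hf : Measurable f) {θ : D.Params}
    (hJ : ∀ᶠ θ' in 𝓝 θ, Integrable (D.objective f) (D.traceLaw τ ρ θ'))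
    (hL : DifferentiableAt ℝ (D.expectedObjective τ ρ f) θ) (u : D.par)
    {S : Type*} [MeasurableSpace S] {ctx : D.TraceSpace R → S}
    (hctx : D.IsAdmissibleContext τ ρ u ctx)
    {Q : P.Space (D.inp u.1) × P.Space (D.out u.1) × S → ℝ}
    (hQ : ∀ᶠ t in 𝓝 (θ u), IsConditionalFutureObjective
      (D.traceLaw τ ρ (Function.update θ u t)) (D.objective f) (D.localVar u ctx) Q)
    (G : AdmissibleGradientOperator (D.kernel u) S) (hQG : Q ∈ G.cls)
    (hG : Integrable (fun ω => G.grad ⟨Q, hQG⟩ (θ u, D.localVar u ctx ω)) (D.traceLaw τ ρ θ)) :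
    HasFDerivAt (fun t => D.expectedObjective τ ρ f (Function.update θ u t))
      (∫ ω, G.grad ⟨Q, hQG⟩ (θ u, D.localVar u ctx ω) ∂(D.traceLaw τ ρ θ)) (θ u) := by
  have hZ := D.measurable_localVar u hctx.1
  have hQm : Measurable Q := G.measurable_cls Q hQG
  -- One measure `lam` serves every `t`; otherwise its variation would contribute to the derivative.
  obtain ⟨lam, hlam, hφ⟩ := hctx.2 θ
  have hk (t : D.Θ u) : IsMarkovKernel ((D.kernel u).hom t).1 := P.isMarkov ((D.kernel u).hom t).2
  have hlaw (t : D.Θ u) := map_eq_map_compProd_of_integral_eq hZ (hφ t)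
  have hup : Filter.Tendsto (Function.update θ u) (𝓝 (θ u)) (𝓝 θ) := by
    simpa using (continuous_const.update u continuous_id : Continuous
      (fun t : D.Θ u => Function.update θ u t)).tendsto (θ u)
  -- Agreement with `F_Q` is needed on a whole neighborhood, with the same `Q`: equality at `θ u`
  -- alone would say nothing about derivatives.
  have hev : ∀ᶠ t in 𝓝 (θ u),
      Integrable (fun z : (P.Space (D.inp u.1) × S) × P.Space (D.out u.1) =>
        Q (z.1.1, z.2, z.1.2)) (lam ⊗ₘ (((D.kernel u).hom t).1.prodMkRight S)) ∧
      D.expectedObjective τ ρ f (Function.update θ u t) =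
        ∫ p, (∫ b, Q (p.1, b, p.2) ∂(((D.kernel u).hom t).1 p.1)) ∂lam := by
    filter_upwards [hQ, hup.eventually hJ] with t hQt hJt
    obtain ⟨hi, he⟩ := hQt.integrable_and_integral_eq hZ
    obtain ⟨hi', he'⟩ :=
      integrable_and_integral_eq_of_map_eq hZ (hlaw t) hQm.stronglyMeasurable hi
    exact ⟨hi', by rw [D.expectedObjective_eq_integral τ ρ hf hJt, ← he, he']⟩
  have heq := hev.mono fun _ h => h.2
  have hdiff : DifferentiableAt ℝ
      (fun t => D.expectedObjective τ ρ f (Function.update θ u t)) (θ u) := by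
    refine DifferentiableAt.comp (g := D.expectedObjective τ ρ f) (θ u) ?_
      (hasFDerivAt_update θ (θ u)).differentiableAt
    simpa using hL
  have hlawθ := hlaw (θ u)
  rw [Function.update_eq_self] at hlawθ
  have hgm : Measurable fun z => G.grad ⟨Q, hQG⟩ (θ u, z) :=
    (G.measurable_grad ⟨Q, hQG⟩).comp (measurable_const.prodMk measurable_id)
  obtain ⟨hi, he⟩ :=
    integrable_and_integral_eq_of_map_eq hZ hlawθ hgm.stronglyMeasurable hG
  rw [he]
  -- Differentiability of `F_Q` is inherited from the objective through `heq`, and the resulting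
  -- derivative is carried back the same way.
  exact (G.hasFDerivAt ⟨Q, hQG⟩ lam (θ u) (hev.mono fun _ h => h.1)
    (hdiff.congr_of_eventuallyEq (Filter.EventuallyEq.symm heq)) hi).congr_of_eventuallyEq heq

end ParameterizedDiagram

theorem mainTheorem1 {K : Type*} [Category K] {CS : ColorSystem K} {P : CMP CS}
    (D : ParameterizedDiagram P) (τ : D.TopologicalOrder) {R : List P.Ob}
    (ρ : Measure (P.Space D.inProfile × P.Space R)) [IsProbabilityMeasure ρ]
    (f : P.Space D.outProfile × P.Space R → ℝ) (hf : Measurable f) (θ : D.Params)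
    (hJ : ∀ᶠ θ' in 𝓝 θ, Integrable (D.objective f) (D.traceLaw τ ρ θ'))
    (hL : DifferentiableAt ℝ (D.expectedObjective τ ρ f) θ)
    (S : D.par → Type*) [∀ u, MeasurableSpace (S u)] [∀ u, StandardBorelSpace (S u)]
    (ctx : (u : D.par) → D.TraceSpace R → S u)
    (hctx : ∀ u, D.IsAdmissibleContext τ ρ u (ctx u))
    (Q : (u : D.par) → P.Space (D.inp u.1) × P.Space (D.out u.1) × S u → ℝ)
    (hQ : ∀ u, ∀ᶠ t in 𝓝 (θ u), IsConditionalFutureObjective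
      (D.traceLaw τ ρ (Function.update θ u t)) (D.objective f) (D.localVar u (ctx u)) (Q u))
    (G : (u : D.par) → AdmissibleGradientOperator (D.kernel u) (S u))
    (hQG : ∀ u, Q u ∈ (G u).cls)
    (hG : ∀ u, Integrable
      (fun ω => (G u).grad ⟨Q u, hQG u⟩ (θ u, D.localVar u (ctx u) ω)) (D.traceLaw τ ρ θ)) :
    HasFDerivAt (D.expectedObjective τ ρ f)
      (∑ u : D.par,
        (∫ ω, (G u).grad ⟨Q u, hQG u⟩ (θ u, D.localVar u (ctx u) ω) ∂(D.traceLaw τ ρ θ)) ∘L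
          (ContinuousLinearMap.proj u : D.Params →L[ℝ] D.Θ u)) θ ∧
    ∀ u : D.par,
      fderiv ℝ (D.expectedObjective τ ρ f) θ ∘L ContinuousLinearMap.single ℝ D.Θ u =
        ∫ ω, (G u).grad ⟨Q u, hQG u⟩ (θ u, D.localVar u (ctx u) ω) ∂(D.traceLaw τ ρ θ) := by
  have hpart (u : D.par) :
      fderiv ℝ (D.expectedObjective τ ρ f) θ ∘L ContinuousLinearMap.single ℝ D.Θ u =
        ∫ ω, (G u).grad ⟨Q u, hQG u⟩ (θ u, D.localVar u (ctx u) ω) ∂(D.traceLaw τ ρ θ) := by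
    refine HasFDerivAt.unique ?_ (D.hasFDerivAt_expectedObjective_update τ ρ hf hJ hL u (hctx u)
      (hQ u) (G u) (hQG u) (hG u))
    have hsingle : HasFDerivAt (Function.update θ u) (ContinuousLinearMap.single ℝ D.Θ u)
        (θ u) := by
      -- The derivative of `Function.update` is given in another form; it matches the inclusion of
      -- the factor `Θ u` coordinate by coordinate.
      convert hasFDerivAt_update (𝕜 := ℝ) θ (θ u) using 1
      ext v w
      rcases eq_or_ne w u with rfl | hw <;> simp [*]
    refine HasFDerivAt.comp (g := D.expectedObjective τ ρ f) (θ u) ?_ hsingle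
    simpa using hL.hasFDerivAt
  refine ⟨?_, hpart⟩
  -- A covector on a finite product is the sum of its restrictions, because `η` is the sum of its
  -- one-factor components.
  convert hL.hasFDerivAt using 1
  refine ContinuousLinearMap.ext fun η => ?_
  simp only [← hpart, sum_apply, ContinuousLinearMap.comp_apply,
    ContinuousLinearMap.proj_apply, ContinuousLinearMap.single_apply]
  rw [← map_sum, Finset.univ_sum_single]
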